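/- Let $d\in\mathbb N$ and let $\mathcal M_d$ be the space of complex $d\times d$ matrices with the Hilbert–Schmidt inner product $\langle A,B\rangle=\operatorname{Tr}(A^\dagger B)$. A linear map $L:\mathcal M_d\to\mathcal M_d$ is a *Lindblad generator* if $$L(\rho)=i[\rho,H]+\sum_{j}\Big(V_j\rho V_j^\dagger-\tfrac12\{V_j^\dagger V_j,\rho\}\Big)$$ for some $H=H^\dagger\in\mathcal M_d$ and some finite family $(V_j)_j$ in $\mathcal M_d$. Let $\mathcal I_d$ be the set of linear maps $T:\mathcal M_d\to\mathcal M_d$ such that for every $\varepsilon>0$ there are $n\in\mathbb N$ and Lindblad generators $G_1,\dots,G_n$ with $\|e^{G_j}-\mathrm{id}\|\le\varepsilon$ for all $j$ and $\prod_{j=1}^n e^{G_j}=T$. The elements of the closure $\overline{\mathcal I}_d$ are the *infinitesimal (Markovian) divisible quantum channels* on $\mathcal M_d$. For a linear map $T:\mathcal M_d\to\mathcal M_d$ let $\det T$ denote its determinant and $s_1^\uparrow(T)\le s_2^\uparrow(T)\le\dots\le s_{d^2}^\uparrow(T)$ its singular values with respect to the Hilbert–Schmidt inner product, in increasing order with multiplicity.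 **Proposition.** Let $T\in\overline{\mathcal I}_d$. Then, for every integer $k$ with $1\le k\le d^2$, the determinant $\det T$ is real and $$0\le\det T\le\Big(\prod_{i=1}^{k}s_i^\uparrow(T)\Big)^{\frac{2d}{k+2\sqrt k+1}}.$$ -/

import Mathlib

open scoped Matrix ComplexOrder

/-- The space `M_d` of complex `d × d` matrices. -/
abbrev Mat (d : ℕ) : Type := Matrix (Fin d) (Fin d) ℂ

attribute [local instance] Matrix.frobeniusNormedAddCommGroup

/-- The Hilbert-Schmidt (Frobenius) inner product `⟪A, B⟫ = Tr (Aᴴ B)` on `M_d`; its norm is the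
Frobenius norm. -/
@[reducible]
noncomputable def hilbertSchmidt (d : ℕ) : InnerProductSpace ℂ (Mat d) where
  __ := (Matrix.frobeniusNormedSpace : NormedSpace ℂ (Mat d))
  inner A B := (Aᴴ * B).trace
  norm_sq_eq_re_inner A := by
    have h : ‖A‖ ^ 2 = ∑ i, ∑ j, ‖A i j‖ ^ 2 := by
      rw [Matrix.frobenius_norm_def, ← Real.sqrt_eq_rpow, Real.sq_sqrt (by positivity)]
      simp
    rw [h, Finset.sum_comm, Matrix.trace, map_sum]
    refine Finset.sum_congr rfl fun j _ => ?_
    rw [Matrix.diag_apply, Matrix.mul_apply, map_sum]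
    refine Finset.sum_congr rfl fun i _ => ?_
    rw [Matrix.conjTranspose_apply, ← starRingEnd_apply, RCLike.conj_mul]
    norm_cast
  conj_inner_symm A B := by
    rw [starRingEnd_apply, ← Matrix.trace_conjTranspose, Matrix.conjTranspose_mul,
      Matrix.conjTranspose_conjTranspose]
  add_left A B C := by
    rw [Matrix.conjTranspose_add, Matrix.add_mul, Matrix.trace_add]
  smul_left A B r := by
    rw [Matrix.conjTranspose_smul, Matrix.smul_mul, Matrix.trace_smul, smul_eq_mul,
      starRingEnd_apply]

attribute [local instance] hilbertSchmidt

/-- Linear operators on a finite-dimensional complex Hilbert space `E` (continuity is then automatic),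
with composition as product and the operator norm. -/
abbrev Operator (E : Type) [NormedAddCommGroup E] [InnerProductSpace ℂ E] : Type := E →L[ℂ] E

/-- Linear maps `M_d → M_d`. -/
abbrev Superoperator (d : ℕ) : Type := Operator (Mat d)

/-- Lindblad (GKLS) generators on `M_d`:
`L(ρ) = i[ρ, H] + ∑ⱼ (Vⱼ ρ Vⱼᴴ - ½ {Vⱼᴴ Vⱼ, ρ})` with `H` Hermitian and finitely many `Vⱼ`. -/
def lindbladGenerators (d : ℕ) : Set (Superoperator d) :=
  {L | ∃ H : Mat d, H.IsHermitian ∧ ∃ (m : ℕ) (V : Fin m → Mat d), ∀ ρ : Mat d,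
    L ρ = Complex.I • (ρ * H - H * ρ) +
      ∑ j, (V j * ρ * (V j)ᴴ -
        (1 / 2 : ℂ) • ((V j)ᴴ * V j * ρ + ρ * ((V j)ᴴ * V j)))}

/-- The set `I_𝒢`: those `T` that, for every `ε > 0`, are a finite product of exponentials
`e^{G_j}`, `G_j ∈ 𝒢`, each within `ε` of the identity. -/
def infinitesimalProducts {d : ℕ} (𝒢 : Set (Superoperator d)) : Set (Superoperator d) :=
  {T | ∀ ε : ℝ, 0 < ε → ∃ (n : ℕ) (G : Fin n → Superoperator d),
    (∀ j, G j ∈ 𝒢) ∧ (∀ j, ‖NormedSpace.exp (G j) - 1‖ ≤ ε) ∧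
      (List.ofFn fun j => NormedSpace.exp (G j)).prod = T}

/-- The infinitesimal (Markovian) divisible quantum channels on `M_d`: the closure of `I_𝒢` for
`𝒢` the set of Lindblad generators. -/
def infinitesimalDivisibleChannels (d : ℕ) : Set (Superoperator d) :=
  closure (infinitesimalProducts (lindbladGenerators d))

/-- `sAsc T i`, for `1 ≤ i ≤ d²`, is the `i`-th smallest singular value of `T` (with multiplicity),
with respect to the Hilbert-Schmidt inner product. Mathlib's `LinearMap.singularValues` is the
decreasing enumeration, starting at the index `0`. -/
noncomputable def sAsc {d : ℕ} (T : Superoperator d) (i : ℕ) : ℝ :=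
  (T : Mat d →ₗ[ℂ] Mat d).singularValues (d ^ 2 - i)

/-!
The determinant of `T` and the product of its `k` smallest singular values are compared through
volumes. If `x` is a `k`-tuple of vectors, the Gram determinant of `T x` is the squared volume of the
image parallelepiped, and for `x` a tuple of right singular vectors belonging to the `k` smallest
singular values it is the square of the product of these (`exists_orthonormal_det_gram_eq`). So it
suffices to bound `det T` by a power of the Gram determinant of `T x` for every orthonormal `x`. That
is a closed condition on `T`, and the estimates behind it multiply along compositions, which leaves a
single exponential `T = e^G` with `G` a Lindblad generator.

For such `G`, `det e^G = e^{tr G}` (`det_exp_eq_exp_trace`). If `∑ᵢ Re ⟪eᵢ, G eᵢ⟫ ≥ -c` for every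
orthonormal `k`-tuple `e`, then the logarithmic derivative of the Gram determinant along `e^{tG}` is
at least `-2c`, so that `e^G` shrinks it by at most `e^{-2c}` (`exp_mul_det_gram_le`). Both quantities
are computed in the gauge where the jump operators `Vⱼ` are traceless. With `N = ∑ⱼ ‖Vⱼ‖²` one has
`tr G = -d N`, and one may take `c = (√k + 1)² N / 2` (`exists_trace_eq_and_le_sum_re_inner`); the
quotient `d / (√k + 1)²` of `d N` by `2c` is the exponent. For the value of `c`, the commutator part
of `G` is skew-adjoint and drops out, and each `V` contributes two terms:

* the anticommutator gives `½ ∑ᵢ (‖V Xᵢ‖² + ‖Xᵢ Vᴴ‖²) ≤ ½ (k + 1) ‖V‖²`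
  (`sum_norm_sq_mul_add_mul_conjTranspose_le`), since for a rank-one projection `P` the squared norms
  of `P Xᵢ` and `Xᵢ P` overlap only in `P Xᵢ P`, and these sum to at most `1` by Bessel's inequality;
* the map `ρ ↦ V ρ Vᴴ` has Hilbert–Schmidt norm `‖V‖²` (`sum_norm_sq_conj_le`), hence partial traces
  of modulus at most `√k ‖V‖²` on `k`-dimensional subspaces.
-/

/-! ### Derivative of the determinant and the exponential -/

/-- Jacobi's formula at the identity matrix. -/
theorem hasDerivAt_det_of_eq_one {ι : Type*} [Fintype ι] [DecidableEq ι] {A : ℝ → Matrix ι ι ℂ}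
    {A' : Matrix ι ι ℂ} {t : ℝ} (hA : ∀ i j, HasDerivAt (fun s => A s i j) (A' i j) t)
    (h1 : A t = 1) : HasDerivAt (fun s => (A s).det) A'.trace t := by
  have hrow : HasDerivAt (fun s => (fun i j => A s i j : ι → ι → ℂ)) (fun i j => A' i j) t :=
    hasDerivAt_pi.2 fun i => hasDerivAt_pi.2 fun j => hA i j
  let D : ContinuousMultilinearMap ℝ (fun _ : ι => ι → ℂ) ℂ :=
    { (Matrix.detRowAlternating (n := ι) (R := ℂ)).toMultilinearMap.restrictScalars ℝ with
      cont := by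
        change Continuous fun M : ι → ι → ℂ => Matrix.det (Matrix.of M)
        exact Continuous.matrix_det (continuous_id) }
  have hD := (D.hasFDerivAt (fun i j => A t i j)).comp_hasDerivAt t hrow
  refine hD.congr_deriv ?_
  rw [ContinuousMultilinearMap.linearDeriv_apply, Matrix.trace]
  refine Finset.sum_congr rfl fun i _ => ?_
  change Matrix.det (Matrix.updateRow (A t) i (A' i)) = _
  have h2 : ∀ v : ι → ℂ, Matrix.det (Matrix.updateRow (1 : Matrix ι ι ℂ) i v) = v i := fun v => by
    rw [← Matrix.det_transpose, ← Matrix.updateCol_transpose, Matrix.transpose_one,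
      ← Matrix.cramer_apply, Matrix.cramer_one]
    rfl
  rw [h1]
  exact h2 _

section Operator

variable {E : Type*} [NormedAddCommGroup E] [InnerProductSpace ℂ E]

/-- Change of basis for the Gram matrix of an image family. -/
theorem gram_linear_combination {ι κ : Type*} [Fintype κ] (B : Matrix ι κ ℂ) (e : κ → E)
    (T : E →L[ℂ] E) :
    Matrix.gram ℂ (fun i => T (∑ j, B i j • e j))
      = B.map star * Matrix.gram ℂ (fun j => T (e j)) * Bᵀ := by
  ext i j
  simp only [Matrix.gram_apply, map_sum, map_smul, sum_inner, inner_sum, inner_smul_left,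
    inner_smul_right, Matrix.mul_apply, Matrix.map_apply, Matrix.transpose_apply,
    Finset.sum_mul]
  refine Finset.sum_congr rfl fun a _ => ?_
  rw [Finset.mul_sum]
  refine Finset.sum_congr rfl fun b _ => ?_
  rw [starRingEnd_apply]
  ring

theorem det_gram_linear_combination {κ : Type*} [Fintype κ] [DecidableEq κ] (B : Matrix κ κ ℂ)
    (e : κ → E) (T : E →L[ℂ] E) :
    (Matrix.gram ℂ (fun i => T (∑ j, B i j • e j))).det.re
      = Complex.normSq B.det * (Matrix.gram ℂ (fun j => T (e j))).det.re := by
  have h : (B.map star).det = starRingEnd ℂ B.det := (RingHom.map_det (starRingEnd ℂ) B).symm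
  rw [gram_linear_combination, Matrix.det_mul, Matrix.det_mul, Matrix.det_transpose, h,
    mul_right_comm, ← Complex.normSq_eq_conj_mul_self, Complex.re_ofReal_mul]

variable [FiniteDimensional ℂ E]

theorem hasDerivAt_exp_smul_apply (L : E →L[ℂ] E) (x : E) (t : ℝ) :
    HasDerivAt (fun s : ℝ => NormedSpace.exp (s • L) x) (NormedSpace.exp (t • L) (L x)) t := by
  have : CompleteSpace E := FiniteDimensional.complete ℂ E
  have h := hasDerivAt_exp_smul_const (𝕂 := ℝ) L t
  exact ((ContinuousLinearMap.apply ℂ E x).restrictScalars ℝ).hasFDerivAt.comp_hasDerivAt t h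

theorem exp_add_smul (L : E →L[ℂ] E) (s t : ℝ) :
    NormedSpace.exp ((s + t) • L) = NormedSpace.exp (s • L) * NormedSpace.exp (t • L) := by
  have : CompleteSpace E := FiniteDimensional.complete ℂ E
  let : NormedAlgebra ℚ (E →L[ℂ] E) := .restrictScalars ℚ ℂ _
  rw [add_smul]
  exact NormedSpace.exp_add_of_commute (((Commute.refl L).smul_left s).smul_right t)

/-- Liouville's formula: the determinant of an exponential is the exponential of the trace. -/
theorem det_exp_eq_exp_trace (L : E →L[ℂ] E) :
    LinearMap.det (NormedSpace.exp L).toLinearMap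
      = Complex.exp (LinearMap.trace ℂ E (L : E →ₗ[ℂ] E)) := by
  have : CompleteSpace E := FiniteDimensional.complete ℂ E
  set τ := LinearMap.trace ℂ E (L : E →ₗ[ℂ] E) with hτ
  let b := stdOrthonormalBasis ℂ E
  let f : ℝ → ℂ := fun t => LinearMap.det (NormedSpace.exp (t • L)).toLinearMap
  have hf0 : HasDerivAt f τ 0 := by
    have h : HasDerivAt (fun s : ℝ => (LinearMap.toMatrix b.toBasis b.toBasis
        (NormedSpace.exp (s • L)).toLinearMap).det)
        (LinearMap.toMatrix b.toBasis b.toBasis (L : E →ₗ[ℂ] E)).trace 0 := by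
      refine hasDerivAt_det_of_eq_one (fun i j => ?_) ?_
      · simp only [LinearMap.toMatrix_apply, OrthonormalBasis.coe_toBasis,
          OrthonormalBasis.coe_toBasis_repr_apply, OrthonormalBasis.repr_apply_apply]
        have h := hasDerivAt_exp_smul_apply L (b j) 0
        simp only [zero_smul, NormedSpace.exp_zero, one_apply_eq_self] at h
        exact ((innerSL ℂ (b i)).restrictScalars ℝ).hasFDerivAt.comp_hasDerivAt 0 h
      · simp only [zero_smul, NormedSpace.exp_zero]
        exact LinearMap.toMatrix_one _
    rw [hτ, LinearMap.trace_eq_matrix_trace ℂ b.toBasis]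
    simpa only [LinearMap.det_toMatrix] using h
  have hf : ∀ t, HasDerivAt f (f t * τ) t := by
    intro t
    have h1 : HasDerivAt (fun s => f t * f (s - t)) (f t * τ) t := by
      refine HasDerivAt.const_mul _ ?_
      have h2 : HasDerivAt f τ (t - t) := by rwa [sub_self]
      exact h2.comp_sub_const t t
    -- The group law `e^{sL} = e^{tL} e^{(s - t)L}` moves the derivative at `t` to the origin.
    refine h1.congr_of_eventuallyEq (Filter.Eventually.of_forall fun s => ?_)
    have : s • L = (t + (s - t)) • L := by congr 1; ring
    simp only [f]
    rw [this, exp_add_smul, ← LinearMap.det_comp]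
    rfl
  have hconst : ∀ t, HasDerivAt (fun t : ℝ => f t * Complex.exp (-(t * τ))) 0 t := by
    intro t
    have he : HasDerivAt (fun t : ℝ => Complex.exp (-((t : ℂ) * τ)))
        (Complex.exp (-((t : ℂ) * τ)) * (-(1 * τ))) t :=
      (((hasDerivAt_id t).ofReal_comp).mul_const τ).neg.cexp
    exact ((hf t).mul he).congr_deriv (by ring)
  have hc := is_const_of_deriv_eq_zero (fun t => (hconst t).differentiableAt)
    (fun t => (hconst t).deriv) 1 0
  have hf00 : f 0 = 1 := by
    simp only [f, zero_smul, NormedSpace.exp_zero]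
    exact LinearMap.det_id
  have hf1 : f 1 = LinearMap.det (NormedSpace.exp L).toLinearMap := by
    simp only [f, one_smul]
  simp only [hf00, Complex.ofReal_zero, zero_mul, neg_zero, Complex.exp_zero, mul_one,
    Complex.ofReal_one, one_mul, hf1, Complex.exp_neg] at hc
  field_simp at hc
  exact hc

/-! ### Volume distortion under an exponential -/

/-- The squared volume of an orthonormal family initially grows under `e^{sL}` at twice the rate of
the trace of the compression of the real part of `L` to its span. -/
theorem hasDerivAt_det_gram_exp_of_orthonormal {κ : Type*} [Fintype κ] [DecidableEq κ]
    (L : E →L[ℂ] E) {e : κ → E} (he : Orthonormal ℂ e) :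
    HasDerivAt (fun s : ℝ => (Matrix.gram ℂ fun i => NormedSpace.exp (s • L) (e i)).det.re)
      (2 * ∑ i, (inner ℂ (e i) (L (e i))).re) 0 := by
  have h : HasDerivAt (fun s : ℝ => (Matrix.gram ℂ fun i => NormedSpace.exp (s • L) (e i)).det)
      (Matrix.of fun i j => inner ℂ (e i) (L (e j)) + inner ℂ (L (e i)) (e j)).trace 0 := by
    refine hasDerivAt_det_of_eq_one (fun i j => ?_) ?_
    · simp only [Matrix.gram_apply, Matrix.of_apply]
      simpa using (hasDerivAt_exp_smul_apply L (e i) 0).inner ℂ (hasDerivAt_exp_smul_apply L (e j) 0)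
    · simpa using Matrix.gram_eq_one_iff_orthonormal.2 he
  have h2 := Complex.reCLM.hasFDerivAt.comp_hasDerivAt (0 : ℝ) h
  refine h2.congr_deriv ?_
  simp only [Matrix.trace, Matrix.diag_apply, Matrix.of_apply, map_sum, Complex.reCLM_apply,
    Complex.add_re, Finset.mul_sum]
  refine Finset.sum_congr rfl fun i _ => ?_
  rw [← inner_conj_symm (L (e i)) (e i), Complex.conj_re]
  ring

/-- If the compressions of the real part of `L` to all `k`-dimensional subspaces have trace at least
`-c`, then `e^L` shrinks `k`-dimensional volumes by a factor of at most `e^{-c}`; the Gram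
determinant is the square of the volume. -/
theorem exp_mul_det_gram_le {k : ℕ} {c : ℝ} {L : E →L[ℂ] E}
    (hL : ∀ e : Fin k → E, Orthonormal ℂ e → -c ≤ ∑ i, (inner ℂ (e i) (L (e i))).re)
    {x : Fin k → E} (hx : LinearIndependent ℂ x) :
    Real.exp (-(2 * c)) * (Matrix.gram ℂ x).det.re
      ≤ (Matrix.gram ℂ fun i => NormedSpace.exp L (x i)).det.re := by
  have : CompleteSpace E := FiniteDimensional.complete ℂ E
  let g : ℝ → ℝ := fun s => (Matrix.gram ℂ fun i => NormedSpace.exp (s • L) (x i)).det.re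
  have hg : ∀ t, ∃ m, HasDerivAt g m t ∧ -(2 * c) * g t ≤ m := by
    intro t
    let y : Fin k → E := fun i => NormedSpace.exp (t • L) (x i)
    have hinj : Function.Injective (NormedSpace.exp (t • L) : E →L[ℂ] E) := by
      have h : (NormedSpace.exp (-(t • L)) * NormedSpace.exp (t • L) : E →L[ℂ] E) = 1 := by
        rw [← neg_smul, ← exp_add_smul, neg_add_cancel, zero_smul, NormedSpace.exp_zero]
      exact Function.LeftInverse.injective (g := (NormedSpace.exp (-(t • L)) : E →L[ℂ] E))
        fun v => congrArg (fun A : E →L[ℂ] E => A v) h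
    have hy : LinearIndependent ℂ y :=
      hx.map' (NormedSpace.exp (t • L)).toLinearMap (LinearMap.ker_eq_bot.2 hinj)
    -- `hL` concerns orthonormal families only, so the moving family is written as `y = B e` with `e`
    -- orthonormal; then `g` near `t` is `|det B|²` times the Gram determinant started from `e`.
    let e := InnerProductSpace.gramSchmidtNormed ℂ y
    have he : Orthonormal ℂ e := InnerProductSpace.gramSchmidtNormed_orthonormal hy
    have hspan : ∀ i, ∃ B : Fin k → ℂ, ∑ j, B j • e j = y i := by
      intro i
      rw [← Submodule.mem_span_range_iff_exists_fun, InnerProductSpace.span_gramSchmidtNormed_range,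
        InnerProductSpace.span_gramSchmidt]
      exact Submodule.subset_span ⟨i, rfl⟩
    choose B hB using hspan
    have hgs : ∀ s, g s = Complex.normSq (Matrix.of B).det *
        (Matrix.gram ℂ fun i => NormedSpace.exp ((s - t) • L) (e i)).det.re := by
      intro s
      rw [← det_gram_linear_combination]
      simp only [g, Matrix.of_apply, hB, y]
      congr 3
      funext i
      rw [← mul_apply_eq_comp, ← exp_add_smul, sub_add_cancel]
    refine ⟨Complex.normSq (Matrix.of B).det * (2 * ∑ i, (inner ℂ (e i) (L (e i))).re), ?_, ?_⟩
    · have h := hasDerivAt_det_gram_exp_of_orthonormal L he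
      rw [← sub_self t] at h
      exact ((h.comp_sub_const t t).const_mul _).congr_of_eventuallyEq
        (Filter.Eventually.of_forall hgs)
    · have h1 : Matrix.gram ℂ e = 1 := Matrix.gram_eq_one_iff_orthonormal.2 he
      have h2 : g t = Complex.normSq (Matrix.of B).det := by
        rw [hgs t]; simp [h1]
      rw [h2]
      have := mul_le_mul_of_nonneg_left (hL e he) (Complex.normSq_nonneg (Matrix.of B).det)
      linarith
  choose m hm hmg using hg
  have hmono : Monotone fun t => g t * Real.exp (2 * c * t) := by
    have hd : ∀ t, HasDerivAt (fun t => g t * Real.exp (2 * c * t))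
        (m t * Real.exp (2 * c * t) + g t * (Real.exp (2 * c * t) * (2 * c * 1))) t := fun t =>
      (hm t).mul ((hasDerivAt_id t).const_mul (2 * c)).exp
    refine monotone_of_hasDerivAt_nonneg hd fun t => ?_
    have := mul_le_mul_of_nonneg_right (hmg t) (Real.exp_pos (2 * c * t)).le
    simp only [Pi.zero_apply]
    linarith
  have h01 := hmono zero_le_one
  have hg0 : g 0 = (Matrix.gram ℂ x).det.re := by simp [g]
  have hg1 : g 1 = (Matrix.gram ℂ fun i => NormedSpace.exp L (x i)).det.re := by simp [g]
  simp only [hg0, hg1, mul_zero, Real.exp_zero, mul_one] at h01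
  rw [Real.exp_neg, inv_mul_le_iff₀ (Real.exp_pos _)]
  linarith

/-! ### Smallest singular values as a volume distortion -/

/-- Right singular vectors for the `k` smallest singular values span a parallelepiped whose image has
as volume the product of these singular values. -/
theorem exists_orthonormal_det_gram_eq {n : ℕ} (hn : Module.finrank ℂ E = n) (T : E →L[ℂ] E)
    {k : ℕ} (hk : k ≤ n) :
    ∃ x : Fin k → E, Orthonormal ℂ x ∧ (Matrix.gram ℂ fun i => T (x i)).det.re
      = (∏ i ∈ Finset.Icc 1 k, T.toLinearMap.singularValues (n - i)) ^ 2 := by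
  set S : E →ₗ[ℂ] E := T.toLinearMap
  have hsym := S.isSymmetric_adjoint_comp_self
  let φ : Fin k → Fin n := fun i => ⟨n - (i + 1), by omega⟩
  have hφ : Function.Injective φ := fun i j h => by
    simp only [φ, Fin.mk.injEq] at h
    ext; omega
  refine ⟨fun i => hsym.eigenvectorBasis hn (φ i),
    (hsym.eigenvectorBasis hn).orthonormal.comp _ hφ, ?_⟩
  have hdiag : (Matrix.gram ℂ fun i => T (hsym.eigenvectorBasis hn (φ i)))
      = Matrix.diagonal fun i : Fin k => ((S.singularValues (n - (i + 1)) ^ 2 : ℝ) : ℂ) := by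
    ext i j
    have h1 : inner ℂ (T (hsym.eigenvectorBasis hn (φ i))) (T (hsym.eigenvectorBasis hn (φ j)))
        = inner ℂ (hsym.eigenvectorBasis hn (φ i))
          ((LinearMap.adjoint S ∘ₗ S) (hsym.eigenvectorBasis hn (φ j))) := by
      rw [LinearMap.comp_apply, LinearMap.adjoint_inner_right]; rfl
    rw [Matrix.gram_apply, h1, hsym.apply_eigenvectorBasis, inner_smul_right,
      OrthonormalBasis.inner_eq_ite, Matrix.diagonal_apply]
    by_cases hij : i = j
    · subst hij
      simp only [if_true, mul_one]
      rw [S.sq_singularValues_of_lt hn (show n - ((i : ℕ) + 1) < n by omega)]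
      rfl
    · rw [if_neg hij, if_neg (hφ.ne hij), mul_zero]
  rw [hdiag, Matrix.det_diagonal, ← Complex.ofReal_prod, Complex.ofReal_re, Finset.prod_pow,
    Fin.prod_univ_eq_prod_range (fun i => S.singularValues (n - (i + 1))),
    Finset.range_eq_Ico, Finset.prod_Ico_add' (fun i => S.singularValues (n - i)), zero_add]
  congr 2

end Operator

/-! ### Hilbert–Schmidt norms of products -/

theorem hilbertSchmidt_inner {d : ℕ} (A B : Mat d) : inner ℂ A B = (Aᴴ * B).trace := rfl

theorem norm_sq_eq_sum_rows {d : ℕ} (A : Mat d) : ‖A‖ ^ 2 = ∑ i, ∑ j, ‖A i j‖ ^ 2 := by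
  rw [Matrix.frobenius_norm_def, ← Real.sqrt_eq_rpow, Real.sq_sqrt (by positivity)]
  simp

theorem norm_sq_eq_re_trace {d : ℕ} (A : Mat d) : ‖A‖ ^ 2 = (Aᴴ * A).trace.re := by
  rw [← hilbertSchmidt_inner]
  exact (hilbertSchmidt d).norm_sq_eq_re_inner A

theorem norm_sq_vecMulVec {d : ℕ} (u w : Fin d → ℂ) :
    ‖(Matrix.vecMulVec u w : Mat d)‖ ^ 2 = (∑ i, ‖u i‖ ^ 2) * ∑ i, ‖w i‖ ^ 2 := by
  simp only [norm_sq_eq_sum_rows, Matrix.vecMulVec_apply, norm_mul, mul_pow, Finset.sum_mul_sum]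

theorem norm_sq_mul_eq_sum_vecMul {d : ℕ} (V X : Mat d) :
    ‖V * X‖ ^ 2 = ∑ r, ∑ s, ‖(V r ᵥ* X) s‖ ^ 2 := norm_sq_eq_sum_rows _

theorem norm_sq_mul_conjTranspose_eq_sum_mulVec {d : ℕ} (V X : Mat d) :
    ‖X * Vᴴ‖ ^ 2 = ∑ r, ∑ s, ‖(X *ᵥ star (V r)) s‖ ^ 2 := by
  rw [norm_sq_eq_sum_rows, Finset.sum_comm]
  rfl

theorem norm_sq_eq_add_of_projection_left {d : ℕ} {P : Mat d} (hP : Pᴴ = P) (hPP : P * P = P)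
    (X : Mat d) : ‖X‖ ^ 2 = ‖P * X‖ ^ 2 + ‖(1 - P) * X‖ ^ 2 := by
  have h : (inner ℂ (P * X) ((1 - P) * X)) = 0 := by
    have h0 : P * (1 - P) = 0 := by rw [mul_sub, mul_one, hPP, sub_self]
    rw [hilbertSchmidt_inner, Matrix.conjTranspose_mul, hP, Matrix.mul_assoc,
      ← Matrix.mul_assoc P, h0, Matrix.zero_mul, Matrix.mul_zero, Matrix.trace_zero]
  have h2 := norm_add_sq_eq_norm_sq_add_norm_sq_of_inner_eq_zero _ _ h
  rw [← Matrix.add_mul, add_sub_cancel, Matrix.one_mul] at h2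
  simpa only [sq] using h2

theorem norm_sq_eq_add_of_projection_right {d : ℕ} {P : Mat d} (hP : Pᴴ = P) (hPP : P * P = P)
    (X : Mat d) : ‖X‖ ^ 2 = ‖X * P‖ ^ 2 + ‖X * (1 - P)‖ ^ 2 := by
  have h := norm_sq_eq_add_of_projection_left hP hPP Xᴴ
  have hQ : (1 - P)ᴴ = 1 - P := by rw [Matrix.conjTranspose_sub, Matrix.conjTranspose_one, hP]
  have h1 : P * Xᴴ = (X * P)ᴴ := by rw [Matrix.conjTranspose_mul, hP]
  have h2 : (1 - P) * Xᴴ = (X * (1 - P))ᴴ := by rw [Matrix.conjTranspose_mul, hQ]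
  rw [h1, h2] at h
  simpa only [Matrix.frobenius_norm_conjTranspose] using h

/-- The difference of the two sides is `‖(1 - P) X (1 - P)‖²`. -/
theorem norm_sq_projection_mul_add_le {d : ℕ} {P : Mat d} (hP : Pᴴ = P) (hPP : P * P = P)
    (X : Mat d) : ‖P * X‖ ^ 2 + ‖X * P‖ ^ 2 ≤ ‖X‖ ^ 2 + ‖P * X * P‖ ^ 2 := by
  have h1 := norm_sq_eq_add_of_projection_left hP hPP X
  have h2 := norm_sq_eq_add_of_projection_left hP hPP (X * P)
  have h3 := norm_sq_eq_add_of_projection_right hP hPP ((1 - P) * X)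
  have h4 := sq_nonneg ‖(1 - P) * X * (1 - P)‖
  rw [← Matrix.mul_assoc, ← Matrix.mul_assoc] at h2
  linarith

theorem inner_vecMulVec {d : ℕ} (v w : Fin d → ℂ) (X : Mat d) :
    inner ℂ (Matrix.vecMulVec (star v) w : Mat d) X = (v ᵥ* X) ⬝ᵥ star w := by
  rw [hilbertSchmidt_inner, Matrix.conjTranspose_vecMulVec, star_star, Matrix.vecMulVec_mul,
    Matrix.trace_vecMulVec, dotProduct_comm]

/-- `norm_sq_projection_mul_add_le` for the rank-one projection onto a unit vector. -/
theorem sum_norm_sq_vecMul_add_mulVec_le_of_unit {d : ℕ} {v : Fin d → ℂ}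
    (hv : ∑ i, ‖v i‖ ^ 2 = 1) (X : Mat d) :
    ∑ s, ‖(v ᵥ* X) s‖ ^ 2 + ∑ s, ‖(X *ᵥ star v) s‖ ^ 2
      ≤ ‖X‖ ^ 2 + ‖inner ℂ (Matrix.vecMulVec (star v) v : Mat d) X‖ ^ 2 := by
  have hvs : ∑ i, ‖(star v) i‖ ^ 2 = 1 := by simpa using hv
  have hvv : v ⬝ᵥ star v = 1 := by
    rw [dotProduct]
    simp only [Pi.star_apply, RCLike.star_def, Complex.mul_conj']
    exact_mod_cast congrArg (fun a : ℝ => (a : ℂ)) hv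
  set P : Mat d := Matrix.vecMulVec (star v) v with hPdef
  have hP : Pᴴ = P := by rw [hPdef, Matrix.conjTranspose_vecMulVec, star_star]
  have hPP : P * P = P := by
    rw [hPdef, Matrix.vecMulVec_mul_vecMulVec, hvv, one_smul]
  have h := norm_sq_projection_mul_add_le hP hPP X
  have h1 : ‖P * X‖ ^ 2 = ∑ s, ‖(v ᵥ* X) s‖ ^ 2 := by
    rw [hPdef, Matrix.vecMulVec_mul, norm_sq_vecMulVec, hvs, one_mul]
  have h2 : ‖X * P‖ ^ 2 = ∑ s, ‖(X *ᵥ star v) s‖ ^ 2 := by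
    rw [hPdef, Matrix.mul_vecMulVec, norm_sq_vecMulVec, hv, mul_one]
  have h3 : ‖P * X * P‖ ^ 2 = ‖inner ℂ P X‖ ^ 2 := by
    rw [hPdef, inner_vecMulVec, Matrix.vecMulVec_mul, Matrix.vecMulVec_mul_vecMulVec,
      norm_sq_vecMulVec, hvs, one_mul]
    simp only [Pi.smul_apply, smul_eq_mul, norm_mul, mul_pow, ← Finset.mul_sum, hv, mul_one]
  linarith

theorem sum_norm_sq_vecMul_add_mulVec_le {d k : ℕ} (v : Fin d → ℂ) {X : Fin k → Mat d}
    (hX : Orthonormal ℂ X) :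
    ∑ i, (∑ s, ‖(v ᵥ* X i) s‖ ^ 2 + ∑ s, ‖(X i *ᵥ star v) s‖ ^ 2)
      ≤ (k + 1) * ∑ s, ‖v s‖ ^ 2 := by
  set a := ∑ s, ‖v s‖ ^ 2 with ha
  have ha0 : 0 ≤ a := by positivity
  rcases ha0.eq_or_lt with h0 | hpos
  · have hv : v = 0 := by
      funext s
      have := (Finset.sum_eq_zero_iff_of_nonneg fun s _ => sq_nonneg ‖v s‖).1 (ha ▸ h0.symm) s
        (Finset.mem_univ s)
      simpa using this
    rw [← h0, hv]
    simp
  · let u : Fin d → ℂ := ((√a : ℝ) : ℂ)⁻¹ • v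
    have hsa : ((√a : ℝ) : ℂ) ≠ 0 := by
      exact_mod_cast (Real.sqrt_pos.2 hpos).ne'
    have hvu : v = ((√a : ℝ) : ℂ) • u := by
      simp only [u, smul_smul, mul_inv_cancel₀ hsa, one_smul]
    have hn : ‖((√a : ℝ) : ℂ)‖ ^ 2 = a := by
      rw [Complex.norm_real, Real.norm_eq_abs, sq_abs, Real.sq_sqrt ha0]
    have hu : ∑ s, ‖u s‖ ^ 2 = 1 := by
      have h : a = a * ∑ s, ‖u s‖ ^ 2 := by
        conv_lhs => rw [ha, hvu]
        simp only [Pi.smul_apply, smul_eq_mul, norm_mul, mul_pow, ← Finset.mul_sum, hn]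
      exact (mul_eq_left₀ hpos.ne').1 h.symm
    have hsum : ∑ i, (∑ s, ‖(v ᵥ* X i) s‖ ^ 2 + ∑ s, ‖(X i *ᵥ star v) s‖ ^ 2)
        = a * ∑ i, (∑ s, ‖(u ᵥ* X i) s‖ ^ 2 + ∑ s, ‖(X i *ᵥ star u) s‖ ^ 2) := by
      conv_lhs => rw [hvu]
      simp only [star_smul, Matrix.smul_vecMul, Matrix.mulVec_smul, Pi.smul_apply, smul_eq_mul,
        norm_mul, mul_pow, norm_star, hn, ← Finset.mul_sum, ← mul_add]
    have hle : ∑ i, (∑ s, ‖(u ᵥ* X i) s‖ ^ 2 + ∑ s, ‖(X i *ᵥ star u) s‖ ^ 2)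
        ≤ ∑ i, (‖X i‖ ^ 2 + ‖inner ℂ (Matrix.vecMulVec (star u) u : Mat d) (X i)‖ ^ 2) :=
      Finset.sum_le_sum fun i _ => sum_norm_sq_vecMul_add_mulVec_le_of_unit hu (X i)
    have hbessel := hX.sum_inner_products_le (x := (Matrix.vecMulVec (star u) u : Mat d))
      (s := Finset.univ)
    have hus : ∑ i, ‖(star u) i‖ ^ 2 = 1 := by simpa using hu
    rw [norm_sq_vecMulVec, hu, hus, one_mul] at hbessel
    have hk : ∑ i, ‖X i‖ ^ 2 = (k : ℝ) := by simp [hX.1]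
    rw [Finset.sum_add_distrib (f := fun i => ‖X i‖ ^ 2), hk] at hle
    simp only [norm_inner_symm (Matrix.vecMulVec (star u) u : Mat d)] at hle
    rw [hsum, mul_comm _ a]
    exact mul_le_mul_of_nonneg_left (hle.trans (by linarith)) ha0

/-- For an orthonormal family `X` of `k` matrices, `V * X` and `X * Vᴴ` together have total squared
norm at most `(k + 1) ‖V‖²`, by summing the estimate for single vectors over the rows of `V`; the
trivial bound is `2k ‖V‖²`. -/
theorem sum_norm_sq_mul_add_mul_conjTranspose_le {d k : ℕ} (V : Mat d) {X : Fin k → Mat d}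
    (hX : Orthonormal ℂ X) :
    ∑ i, (‖V * X i‖ ^ 2 + ‖X i * Vᴴ‖ ^ 2) ≤ (k + 1) * ‖V‖ ^ 2 := by
  simp only [norm_sq_mul_conjTranspose_eq_sum_mulVec]
  simp only [norm_sq_mul_eq_sum_vecMul, ← Finset.sum_add_distrib]
  rw [Finset.sum_comm, norm_sq_eq_sum_rows V, Finset.mul_sum]
  refine Finset.sum_le_sum fun r _ => ?_
  simpa only [← Finset.sum_add_distrib] using sum_norm_sq_vecMul_add_mulVec_le (V r) hX

/-- Conjugation by `V` has Hilbert–Schmidt norm `‖V‖²` as a superoperator. Each entry of `V X Vᴴ` is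
the inner product of `X` with a rank-one matrix, to which Bessel's inequality applies. -/
theorem sum_norm_sq_conj_le {d k : ℕ} (V : Mat d) {X : Fin k → Mat d} (hX : Orthonormal ℂ X) :
    ∑ i, ‖V * X i * Vᴴ‖ ^ 2 ≤ (‖V‖ ^ 2) ^ 2 := by
  have hentry : ∀ i r s, (V * X i * Vᴴ) r s
      = inner ℂ (Matrix.vecMulVec (star (V r)) (V s) : Mat d) (X i) := fun i r s => by
    rw [inner_vecMulVec]; rfl
  simp only [norm_sq_eq_sum_rows (_ * _ * _), hentry]
  rw [Finset.sum_comm]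
  simp only [Finset.sum_comm (s := (Finset.univ : Finset (Fin k)))]
  rw [norm_sq_eq_sum_rows V, sq, Finset.sum_mul_sum]
  refine Finset.sum_le_sum fun r _ => Finset.sum_le_sum fun s _ => ?_
  have h := hX.sum_inner_products_le (x := (Matrix.vecMulVec (star (V r)) (V s) : Mat d))
    (s := Finset.univ)
  simp only [norm_inner_symm _ (Matrix.vecMulVec (star (V r)) (V s) : Mat d), norm_sq_vecMulVec,
    Pi.star_apply, norm_star] at h
  exact h

theorem neg_sum_re_inner_conj_le {d k : ℕ} (V : Mat d) {X : Fin k → Mat d}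
    (hX : Orthonormal ℂ X) :
    -(√k * ‖V‖ ^ 2) ≤ ∑ i, (inner ℂ (X i) (V * X i * Vᴴ)).re := by
  have h1 : ∀ i, -‖V * X i * Vᴴ‖ ≤ (inner ℂ (X i) (V * X i * Vᴴ)).re := fun i => by
    have h := norm_inner_le_norm (𝕜 := ℂ) (X i) (V * X i * Vᴴ)
    rw [hX.1, one_mul] at h
    have := (Complex.abs_re_le_norm (inner ℂ (X i) (V * X i * Vᴴ))).trans h
    exact (abs_le.1 this).1
  have h2 : ∑ i, ‖V * X i * Vᴴ‖ ≤ √k * ‖V‖ ^ 2 := by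
    refine le_of_sq_le_sq ?_ (by positivity)
    have h := sq_sum_le_card_mul_sum_sq (s := (Finset.univ : Finset (Fin k)))
      (f := fun i => ‖V * X i * Vᴴ‖)
    rw [Finset.card_univ, Fintype.card_fin] at h
    rw [mul_pow, Real.sq_sqrt (Nat.cast_nonneg k)]
    exact h.trans (mul_le_mul_of_nonneg_left (sum_norm_sq_conj_le V hX) (Nat.cast_nonneg k))
  have h3 := Finset.sum_le_sum fun i (_ : i ∈ Finset.univ) => h1 i
  rw [Finset.sum_neg_distrib] at h3
  linarith

/-! ### The real part and the trace of a Lindblad generator -/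

/-- The dissipator `ρ ↦ V ρ Vᴴ - ½ {Vᴴ V, ρ}` of a single jump operator `V`. -/
noncomputable def dissipator {d : ℕ} (V ρ : Mat d) : Mat d :=
  V * ρ * Vᴴ - (1 / 2 : ℂ) • (Vᴴ * V * ρ + ρ * (Vᴴ * V))

theorem neg_le_sum_re_inner_dissipator {d k : ℕ} (V : Mat d) {X : Fin k → Mat d}
    (hX : Orthonormal ℂ X) :
    -((√k + 1) ^ 2 / 2 * ‖V‖ ^ 2) ≤ ∑ i, (inner ℂ (X i) (dissipator V (X i))).re := by
  have h : ∀ i, (inner ℂ (X i) (dissipator V (X i))).re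
      = (inner ℂ (X i) (V * X i * Vᴴ)).re - 1 / 2 * (‖V * X i‖ ^ 2 + ‖X i * Vᴴ‖ ^ 2) := by
    intro i
    have h1 : (inner ℂ (X i) (Vᴴ * V * X i)).re = ‖V * X i‖ ^ 2 := by
      rw [hilbertSchmidt_inner, norm_sq_eq_re_trace, Matrix.conjTranspose_mul]
      simp only [Matrix.mul_assoc]
    have h2 : (inner ℂ (X i) (X i * (Vᴴ * V))).re = ‖X i * Vᴴ‖ ^ 2 := by
      rw [hilbertSchmidt_inner, norm_sq_eq_re_trace, Matrix.conjTranspose_mul,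
        Matrix.conjTranspose_conjTranspose, Matrix.mul_assoc V, Matrix.trace_mul_comm V]
      simp only [Matrix.mul_assoc]
    have h3 : (1 / 2 : ℂ) = ((1 / 2 : ℝ) : ℂ) := by push_cast; rfl
    rw [dissipator, inner_sub_right, inner_smul_right, inner_add_right, Complex.sub_re, h3,
      Complex.re_ofReal_mul, Complex.add_re, h1, h2]
  simp only [h, Finset.sum_sub_distrib, ← Finset.mul_sum]
  have hA := sum_norm_sq_mul_add_mul_conjTranspose_le V hX
  have hB := neg_sum_re_inner_conj_le V hX
  have hk : (√k : ℝ) ^ 2 = k := Real.sq_sqrt (Nat.cast_nonneg k)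
  have : (√k + 1) ^ 2 / 2 * ‖V‖ ^ 2 = √k * ‖V‖ ^ 2 + 1 / 2 * ((k + 1) * ‖V‖ ^ 2) := by
    rw [add_sq, hk]; ring
  linarith

theorem re_inner_commutator_eq_zero {d : ℕ} {K : Mat d} (hK : Kᴴ = -K) (X : Mat d) :
    (inner ℂ X (K * X - X * K)).re = 0 := by
  have h1 : (inner ℂ X (K * X)).re = 0 := by
    have h : star (Xᴴ * (K * X)).trace = -(Xᴴ * (K * X)).trace := by
      rw [← Matrix.trace_conjTranspose, Matrix.conjTranspose_mul, Matrix.conjTranspose_mul, hK,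
        Matrix.conjTranspose_conjTranspose, Matrix.mul_neg, Matrix.neg_mul, Matrix.trace_neg,
        Matrix.mul_assoc]
    have := congrArg Complex.re h
    simp only [RCLike.star_def, Complex.conj_re, Complex.neg_re] at this
    rw [hilbertSchmidt_inner]
    linarith
  have h2 : (inner ℂ X (X * K)).re = 0 := by
    have h : star (Xᴴ * (X * K)).trace = -(Xᴴ * (X * K)).trace := by
      rw [← Matrix.trace_conjTranspose, Matrix.conjTranspose_mul, Matrix.conjTranspose_mul, hK,
        Matrix.conjTranspose_conjTranspose, Matrix.neg_mul, Matrix.neg_mul, Matrix.trace_neg,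
        Matrix.mul_assoc, Matrix.trace_mul_comm, Matrix.mul_assoc]
    have := congrArg Complex.re h
    simp only [RCLike.star_def, Complex.conj_re, Complex.neg_re] at this
    rw [hilbertSchmidt_inner]
    linarith
  rw [inner_sub_right, Complex.sub_re, h1, h2, sub_zero]

/-- Shifting a jump operator by a scalar changes the dissipator by a commutator with a
skew-Hermitian matrix. -/
theorem dissipator_add_smul_one {d : ℕ} (W : Mat d) (c : ℂ) :
    ∃ K : Mat d, Kᴴ = -K ∧ ∀ ρ, dissipator (W + c • 1) ρ = dissipator W ρ + (K * ρ - ρ * K) := by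
  refine ⟨(1 / 2 : ℂ) • (star c • W - c • Wᴴ), ?_, fun ρ => ?_⟩
  · simp only [Matrix.conjTranspose_smul, Matrix.conjTranspose_sub, star_star,
      Matrix.conjTranspose_conjTranspose, ← smul_neg, neg_sub]
    simp
  · simp only [dissipator, Matrix.conjTranspose_add, Matrix.conjTranspose_smul,
      Matrix.conjTranspose_one, Matrix.add_mul, Matrix.mul_add, Matrix.sub_mul, Matrix.mul_sub,
      Matrix.smul_mul, Matrix.mul_smul, Matrix.one_mul, Matrix.mul_one, smul_sub, smul_add,
      smul_smul, Matrix.mul_assoc]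
    module

theorem trace_mulLeftRight {d : ℕ} (A B : Mat d) :
    LinearMap.trace ℂ (Mat d) (LinearMap.mulLeftRight ℂ (A, B)) = A.trace * B.trace := by
  rw [LinearMap.trace_eq_matrix_trace ℂ (Matrix.stdBasis ℂ (Fin d) (Fin d)), Matrix.trace,
    Fintype.sum_prod_type, Matrix.trace, Matrix.trace, Finset.sum_mul_sum]
  refine Finset.sum_congr rfl fun i _ => Finset.sum_congr rfl fun j _ => ?_
  rw [Matrix.diag_apply, LinearMap.toMatrix_apply, Matrix.stdBasis_eq_single]
  simp [Matrix.stdBasis, Matrix.mul_apply, Matrix.single_apply, ite_and]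

/-- The jump operators of a Lindblad generator may be taken traceless, by shifting each by a scalar and
absorbing the resulting commutators into the Hamiltonian part. -/
theorem exists_commutator_add_dissipators {d : ℕ} (hd : d ≠ 0) {G : Superoperator d}
    (hG : G ∈ lindbladGenerators d) :
    ∃ K : Mat d, Kᴴ = -K ∧ ∃ (m : ℕ) (W : Fin m → Mat d), (∀ j, (W j).trace = 0) ∧
      ∀ ρ, G ρ = (K * ρ - ρ * K) + ∑ j, dissipator (W j) ρ := by
  obtain ⟨H, hH, m, V, hV⟩ := hG
  let c : Fin m → ℂ := fun j => (V j).trace / d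
  let W : Fin m → Mat d := fun j => V j - c j • 1
  have hW : ∀ j, W j + c j • 1 = V j := fun j => sub_add_cancel _ _
  choose K hK hKW using fun j => dissipator_add_smul_one (W j) (c j)
  refine ⟨-(Complex.I • H) + ∑ j, K j, ?_, m, W, fun j => ?_, fun ρ => ?_⟩
  · rw [Matrix.conjTranspose_add, Matrix.conjTranspose_neg, Matrix.conjTranspose_smul,
      Matrix.conjTranspose_sum, hH.eq]
    simp only [hK, Finset.sum_neg_distrib, RCLike.star_def, Complex.conj_I]
    module
  · have : (d : ℂ) ≠ 0 := Nat.cast_ne_zero.2 hd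
    simp only [W, c, Matrix.trace_sub, Matrix.trace_smul, Matrix.trace_one, Fintype.card_fin,
      smul_eq_mul]
    field_simp
    ring
  · have hj : ∀ j, V j * ρ * (V j)ᴴ - (1 / 2 : ℂ) • ((V j)ᴴ * V j * ρ + ρ * ((V j)ᴴ * V j))
        = dissipator (W j) ρ + (K j * ρ - ρ * K j) := fun j => by
      rw [← hKW, hW]; rfl
    rw [hV]
    simp only [hj, Finset.sum_add_distrib, Finset.sum_sub_distrib, Matrix.add_mul, Matrix.mul_add,
      Finset.sum_mul, Finset.mul_sum, Matrix.neg_mul, Matrix.mul_neg, Matrix.smul_mul,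
      Matrix.mul_smul]
    module

/-- A Lindblad generator with traceless jump operators of total squared norm `N` has trace `-d N`,
while its real part loses at most `(√k + 1)² N / 2` on any `k`-dimensional subspace. -/
theorem exists_trace_eq_and_le_sum_re_inner {d : ℕ} (hd : d ≠ 0) {G : Superoperator d}
    (hG : G ∈ lindbladGenerators d) :
    ∃ N : ℝ, LinearMap.trace ℂ (Mat d) G.toLinearMap = ((-(d * N) : ℝ) : ℂ) ∧
      ∀ (k : ℕ) (X : Fin k → Mat d), Orthonormal ℂ X →
        -((√k + 1) ^ 2 / 2 * N) ≤ ∑ i, (inner ℂ (X i) (G (X i))).re := by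
  obtain ⟨K, hK, m, W, hW, hGW⟩ := exists_commutator_add_dissipators hd hG
  refine ⟨∑ j, ‖W j‖ ^ 2, ?_, fun k X hX => ?_⟩
  · have hlin : G.toLinearMap = LinearMap.mulLeftRight ℂ (K, 1) - LinearMap.mulLeftRight ℂ (1, K)
        + ∑ j, (LinearMap.mulLeftRight ℂ (W j, (W j)ᴴ) - (1 / 2 : ℂ) •
          (LinearMap.mulLeftRight ℂ ((W j)ᴴ * W j, 1)
            + LinearMap.mulLeftRight ℂ (1, (W j)ᴴ * W j))) := by
      refine LinearMap.ext fun ρ => ?_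
      have h := hGW ρ
      simpa [dissipator, LinearMap.sum_apply] using h
    have htr : ∀ j, ((W j)ᴴ * W j).trace = ((‖W j‖ ^ 2 : ℝ) : ℂ) := fun j => by
      rw [← hilbertSchmidt_inner, inner_self_eq_norm_sq_to_K]
      push_cast
      rfl
    rw [hlin]
    simp only [map_add, map_sub, map_sum, map_smul, trace_mulLeftRight, hW, htr, Matrix.trace_one,
      Fintype.card_fin, zero_mul, smul_eq_mul]
    push_cast
    rw [Finset.mul_sum, ← Finset.sum_neg_distrib, mul_comm K.trace, sub_self, zero_add]
    refine Finset.sum_congr rfl fun j _ => ?_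
    ring
  · simp only [hGW, inner_add_right, inner_sum, Complex.add_re, Complex.re_sum,
      re_inner_commutator_eq_zero hK, zero_add]
    rw [Finset.sum_comm, Finset.mul_sum, ← Finset.sum_neg_distrib]
    exact Finset.sum_le_sum fun j _ => neg_le_sum_re_inner_dissipator (W j) hX

/-! ### Products of exponentials and their limits -/

/-- `T` has determinant `e^{-dN}` and shrinks squared `k`-dimensional volumes by a factor of at most
`e^{-(√k + 1)² N}`. -/
def HasVolumeRate {d : ℕ} (k : ℕ) (T : Superoperator d) (N : ℝ) : Prop :=
  LinearMap.det T.toLinearMap = Real.exp (-(d * N)) ∧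
    ∀ x : Fin k → Mat d, LinearIndependent ℂ x →
      Real.exp (-((√k + 1) ^ 2 * N)) * (Matrix.gram ℂ x).det.re
        ≤ (Matrix.gram ℂ fun i => T (x i)).det.re

theorem HasVolumeRate.one {d k : ℕ} : HasVolumeRate k (1 : Superoperator d) 0 := by
  refine ⟨?_, fun x _ => ?_⟩
  · simp
  · simp

/-- The lower bound on the Gram determinant is positive, so independence is preserved. -/
theorem HasVolumeRate.linearIndependent {d k : ℕ} {T : Superoperator d} {N : ℝ}
    (hT : HasVolumeRate k T N) {x : Fin k → Mat d} (hx : LinearIndependent ℂ x) :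
    LinearIndependent ℂ fun i => T (x i) := by
  refine Matrix.linearIndependent_of_det_gram_ne_zero (𝕜 := ℂ) fun h => ?_
  have h1 := hT.2 x hx
  rw [h, Complex.zero_re] at h1
  have h2 : 0 < (Matrix.gram ℂ x).det.re :=
    (Complex.lt_def.1 (Matrix.posDef_gram_of_linearIndependent hx).det_pos).1
  exact absurd h1 (not_le.2 (mul_pos (Real.exp_pos _) h2))

theorem HasVolumeRate.mul {d k : ℕ} {S T : Superoperator d} {M N : ℝ}
    (hS : HasVolumeRate k S M) (hT : HasVolumeRate k T N) : HasVolumeRate k (S * T) (M + N) := by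
  refine ⟨?_, fun x hx => ?_⟩
  · have h : (S * T).toLinearMap = S.toLinearMap ∘ₗ T.toLinearMap := rfl
    rw [h, LinearMap.det_comp, hS.1, hT.1, ← Complex.ofReal_mul, ← Real.exp_add]
    congr 2
    ring
  · have h1 := hT.2 x hx
    have h2 := hS.2 _ (hT.linearIndependent hx)
    have h3 : Real.exp (-((√k + 1) ^ 2 * (M + N)))
        = Real.exp (-((√k + 1) ^ 2 * M)) * Real.exp (-((√k + 1) ^ 2 * N)) := by
      rw [← Real.exp_add]
      congr 1
      ring
    rw [h3, mul_assoc]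
    exact (mul_le_mul_of_nonneg_left h1 (Real.exp_pos _).le).trans h2

theorem exists_hasVolumeRate_exp {d k : ℕ} (hd : d ≠ 0) {G : Superoperator d}
    (hG : G ∈ lindbladGenerators d) : ∃ N, HasVolumeRate k (NormedSpace.exp G) N := by
  obtain ⟨N, htr, hre⟩ := exists_trace_eq_and_le_sum_re_inner hd hG
  refine ⟨N, ?_, fun x hx => ?_⟩
  · rw [det_exp_eq_exp_trace, htr, Complex.ofReal_exp]
  · have h := exp_mul_det_gram_le (hre k) hx
    rwa [show 2 * ((√k + 1) ^ 2 / 2 * N) = (√k + 1) ^ 2 * N by ring] at h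

theorem exists_hasVolumeRate_of_mem_infinitesimalProducts {d k : ℕ} (hd : d ≠ 0)
    {T : Superoperator d} (hT : T ∈ infinitesimalProducts (lindbladGenerators d)) :
    ∃ N, HasVolumeRate k T N := by
  -- Smallness of the factors plays no role: any one factorization into exponentials will do.
  obtain ⟨n, G, hG, -, rfl⟩ := hT 1 one_pos
  refine List.prod_induction (fun T => ∃ N, HasVolumeRate k T N)
    (fun S T ⟨M, hM⟩ ⟨N, hN⟩ => ⟨M + N, hM.mul hN⟩) ⟨0, HasVolumeRate.one⟩ ?_
  rw [List.forall_mem_ofFn_iff]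
  exact fun j => exists_hasVolumeRate_exp hd (hG j)

theorem HasVolumeRate.det_le {d k : ℕ} {T : Superoperator d} {N : ℝ} (hT : HasVolumeRate k T N)
    {x : Fin k → Mat d} (hx : Orthonormal ℂ x) :
    LinearMap.det T.toLinearMap ≤
      (((Matrix.gram ℂ fun i => T (x i)).det.re ^ ((d : ℝ) / (√k + 1) ^ 2) : ℝ) : ℂ) := by
  have h := hT.2 x hx.linearIndependent
  rw [Matrix.gram_eq_one_iff_orthonormal.2 hx, Matrix.det_one, Complex.one_re, mul_one] at h
  have h2 := Real.rpow_le_rpow (z := (d : ℝ) / (√k + 1) ^ 2) (Real.exp_pos _).le h (by positivity)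
  rw [← Real.exp_mul] at h2
  have hne : (√k + 1) ^ 2 ≠ 0 := by positivity
  rw [show -((√k + 1) ^ 2 * N) * ((d : ℝ) / (√k + 1) ^ 2) = -(d * N) by field_simp] at h2
  rw [hT.1]
  exact_mod_cast h2

theorem isClosed_setOf_det_le {d k : ℕ} (x : Fin k → Mat d) {p : ℝ} (hp : 0 ≤ p) :
    IsClosed {T : Superoperator d | 0 ≤ LinearMap.det T.toLinearMap ∧
      LinearMap.det T.toLinearMap ≤ (((Matrix.gram ℂ fun i => T (x i)).det.re ^ p : ℝ) : ℂ)} := by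
  have hdet : Continuous fun T : Superoperator d => LinearMap.det T.toLinearMap :=
    ContinuousLinearMap.continuous_det
  have hgram : Continuous fun T : Superoperator d => (Matrix.gram ℂ fun i => T (x i)) := by
    refine continuous_matrix fun i j => ?_
    simp only [Matrix.gram_apply]
    exact (ContinuousLinearMap.apply ℂ (Mat d) (x i)).continuous.inner
      (ContinuousLinearMap.apply ℂ (Mat d) (x j)).continuous
  have hrhs := Complex.continuous_ofReal.comp
    ((Complex.continuous_re.comp hgram.matrix_det).rpow_const fun _ => Or.inr hp)
  exact (isClosed_le continuous_const hdet).inter (isClosed_le hdet hrhs)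

theorem det_le_of_mem_infinitesimalDivisibleChannels {d k : ℕ} (hd : d ≠ 0) {T : Superoperator d}
    (hT : T ∈ infinitesimalDivisibleChannels d) {x : Fin k → Mat d} (hx : Orthonormal ℂ x) :
    0 ≤ LinearMap.det T.toLinearMap ∧ LinearMap.det T.toLinearMap ≤
      (((Matrix.gram ℂ fun i => T (x i)).det.re ^ ((d : ℝ) / (√k + 1) ^ 2) : ℝ) : ℂ) := by
  refine closure_minimal (fun S hS => ?_)
    (isClosed_setOf_det_le x (p := (d : ℝ) / (√k + 1) ^ 2) (by positivity)) hT
  obtain ⟨N, hN⟩ := exists_hasVolumeRate_of_mem_infinitesimalProducts (k := k) hd hS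
  refine ⟨?_, hN.det_le hx⟩
  rw [hN.1]
  exact_mod_cast (Real.exp_pos _).le

theorem proposition4p15 (d : ℕ) (T : Superoperator d) (hT : T ∈ infinitesimalDivisibleChannels d)
    (k : ℕ) (hk : 1 ≤ k) (hkd : k ≤ d ^ 2) :
    0 ≤ LinearMap.det (T : Mat d →ₗ[ℂ] Mat d) ∧
      LinearMap.det (T : Mat d →ₗ[ℂ] Mat d) ≤
        (((∏ i ∈ Finset.Icc 1 k, sAsc T i) ^
          (2 * (d : ℝ) / ((k : ℝ) + 2 * Real.sqrt k + 1)) : ℝ) : ℂ) := by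
  -- `1 ≤ k ≤ d ^ 2` excludes `d = 0`, so that dividing a trace by `d` is legitimate.
  have hd : d ≠ 0 := by
    rintro rfl
    simp at hkd
    omega
  have hfin : Module.finrank ℂ (Mat d) = d ^ 2 := by
    rw [Module.finrank_matrix]
    simp [sq]
  obtain ⟨x, hx, hgram⟩ := exists_orthonormal_det_gram_eq hfin T hkd
  have h := det_le_of_mem_infinitesimalDivisibleChannels hd hT hx
  have hs : 0 ≤ ∏ i ∈ Finset.Icc 1 k, sAsc T i :=
    Finset.prod_nonneg fun i _ => LinearMap.singularValues_nonneg _ _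
  have hexp : 2 * (d : ℝ) / ((k : ℝ) + 2 * √k + 1) = (2 : ℕ) * ((d : ℝ) / (√k + 1) ^ 2) := by
    rw [add_sq, Real.sq_sqrt (Nat.cast_nonneg k)]
    push_cast
    ring
  rw [hexp, Real.rpow_mul hs, Real.rpow_natCast]
  rw [hgram] at h
  exact h
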